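/- Let $F$ be a field of characteristic $2$, let $n$ be a natural number, and let $A \in M_n(F)$ be an $n \times n$ matrix with entries in $F$. Then $A$ is a sum of three square-zero matrices, i.e. there exist $S_1, S_2, S_3 \in M_n(F)$ with $S_1^2 = S_2^2 = S_3^2 = 0$ and $A = S_1 + S_2 + S_3$, if and only if $\operatorname{tr} A = 0$. -/

import Mathlib

/-!
In characteristic two a trace-zero matrix is a sum of three square-zero matrices. Conversely, a
square-zero matrix is nilpotent, so its trace vanishes.

If `P` is idempotent and `G * P + P * G = G`, then `G` interchanges the two summands of the
grading defined by `P`, and `G = G * P + P * G` is a sum of two square-zero matrices. It therefore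
suffices to write a trace-zero matrix as a square-zero matrix `S` plus such an odd matrix `G`.

The matrix is decomposed into cyclic blocks `B₁, …, Bᵣ` with traces `t₁, …, tᵣ`. For every scalar
`a`, a cyclic block of size at least two has a basis in which it is the shift plus a last column,
except for the entry `a` in the top left corner; the bottom right entry `b` then satisfies
`a + b = t`. Choose `a₁ = 0` and `aᵢ₊₁ = bᵢ`, so that `bᵢ = t₁ + ⋯ + tᵢ` and `bᵣ = 0`. Let `S`
consist of all last columns without their bottom entries, together with entries `1` that link
the last basis vector of each block to the first basis vector of the next one. Then `S` is
square-zero. In `A - S` all blocks form one long shift with diagonal entries that come in adjacent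
equal pairs `bᵢ, aᵢ₊₁`; such a pair contributes the factor `(X - bᵢ)² = X² + bᵢ²`, so the
characteristic polynomial contains only exponents of one parity, and `A - S` is odd for the parity
of the position, after adding a multiple of the last vector of each block to the first vector of
the next block. `HasChainForm.directSum_link` performs this linking for one block at a time.

Blocks of size one do not have the required freedom. Two of them with distinct eigenvalues form a
cyclic block of size two; two with the same eigenvalue `t` form `t • 1`, which is handled directly
(`hasChainForm_fromBlocks_self`); so at most one is left over. Since the total trace is zero, its
eigenvalue equals the trace of the rest, and it can be linked as the last block
(`LinearMap.IsAlmostChain.hasChainForm_zero`).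
-/

open Matrix Polynomial Module

/-! ### Linking blocks of matrices -/

section Blocks

theorem add_self_eq_zero_of_charTwo {F m n : Type*} [Field F] [CharP F 2] (M : Matrix m n F) :
    M + M = 0 := by
  ext
  simp [CharTwo.add_self_eq_zero]

variable {F : Type*} [Field F] {m n : Type*} [Fintype m] [Fintype n]

/-- `A` is the sum of a square-zero matrix `S`, a matrix `G` that is odd for the grading defined by
the idempotent `P`, and a matrix `w * φ` of rank at most one. The column `w` is `t` times the last
basis vector of the chain of blocks and the row `φ` is the coordinate along that vector, so that
`w * φ` is the bottom right diagonal entry `t`. The last vector and its coordinate are even, `S`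
does not map into the last vector, and `G` kills it. When `t = 0` the decomposition is `A = S + G`;
then `φ` carries no information, and may be zero. -/
def HasChainForm (A : Matrix n n F) (t : F) : Prop :=
  ∃ (S G P : Matrix n n F) (w : Matrix n Unit F) (φ : Matrix Unit n F),
    A = S + G + w * φ ∧ S * S = 0 ∧ P * P = P ∧ G * P + P * G = G ∧
      φ * S = 0 ∧ G * w = 0 ∧ P * w = w ∧ φ * P = φ ∧ φ * w = t • 1 ∧ (t = 0 → w = 0)

/-- `B` is a block that can be appended to a chain whose last diagonal entry is `t`, the last
diagonal entry of the resulting chain being `s`. The column `u` and the row `α` are the first basis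
vector of the block and its coordinate, so that `t • (u * α)` is the top left diagonal entry `t`;
the column `w` and the row `φ` are as in `HasChainForm`, but may have either parity. The first
vector is odd, `S` kills it and `G` does not map into it. -/
def HasLinkForm (B : Matrix n n F) (t s : F) : Prop :=
  ∃ (S G P : Matrix n n F) (u w : Matrix n Unit F) (α φ : Matrix Unit n F),
    B = S + G + t • (u * α) + w * φ ∧ S * S = 0 ∧ P * P = P ∧ G * P + P * G = G ∧
      φ * S = 0 ∧ G * w = 0 ∧ φ * w = s • 1 ∧ (s = 0 → w = 0) ∧
      α * u = 1 ∧ α * G = 0 ∧ P * u = 0 ∧ α * P = 0 ∧ S * u = 0 ∧ α * w = 0 ∧ φ * u = 0 ∧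
      ((P * w = w ∧ φ * P = φ) ∨ (P * w = 0 ∧ φ * P = 0))

/-- The last vector of a chain may also be odd: replace the grading `P` by `1 - P`. -/
theorem HasChainForm.of_parity [DecidableEq n] {A S G P : Matrix n n F}
    {w : Matrix n Unit F} {φ : Matrix Unit n F} {t : F} [CharP F 2]
    (hA : A = S + G + w * φ) (hS : S * S = 0) (hP : P * P = P) (hG : G * P + P * G = G)
    (hφS : φ * S = 0) (hGw : G * w = 0) (hφw : φ * w = t • 1) (ht : t = 0 → w = 0)
    (h : (P * w = w ∧ φ * P = φ) ∨ (P * w = 0 ∧ φ * P = 0)) : HasChainForm A t := by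
  rcases h with ⟨h₁, h₂⟩ | ⟨h₁, h₂⟩
  · exact ⟨S, G, P, w, φ, hA, hS, hP, hG, hφS, hGw, h₁, h₂, hφw, ht⟩
  · refine ⟨S, G, 1 - P, w, φ, hA, hS, ?_, ?_, hφS, hGw, ?_, ?_, hφw, ht⟩
    · simp [mul_sub, sub_mul, hP]
    · have : G * (1 - P) + (1 - P) * G = G + G - (G * P + P * G) := by noncomm_ring
      rw [this, hG, add_sub_cancel_right]
    · simp [Matrix.sub_mul, h₁]
    · simp [Matrix.mul_sub, h₂]

/-- Appending a block to a chain. The link `u * φ`, which maps the last vector of the chain to the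
first vector of the block, is added to both the square-zero part and the odd part, which changes
nothing in characteristic two. -/
theorem HasChainForm.directSum_link [CharP F 2] [DecidableEq n] [DecidableEq m]
    {A : Matrix m m F} {B : Matrix n n F} {t s : F}
    (hA : HasChainForm A t) (hB : HasLinkForm B t s) : HasChainForm (fromBlocks A 0 0 B) s := by
  obtain ⟨S, G, P, w, φ, rfl, hS, hP, hG, hφS, hGw, hPw, hφP, hφw, ht⟩ := hA
  obtain ⟨S', G', P', u, w', α, φ', rfl, hS', hP', hG', hφS', hGw', hφw', hs, hαu, hαG, hPu, hαP,
    hSu, hαw, hφu, hpar⟩ := hB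
  -- The grading is `fromBlocks P 0 0 P'` conjugated by `1 + w * α`: the first vector `u` of the
  -- block is replaced by the odd vector `u + w`, the image of the last vector of the chain.
  refine HasChainForm.of_parity (S := fromBlocks S 0 (u * φ) S')
    (G := fromBlocks (G + w * φ) 0 (u * φ) (G' + t • (u * α)))
    (P := fromBlocks P (w * α) 0 P')
    (w := fromRows 0 w') (φ := fromCols 0 φ') ?_ ?_ ?_ ?_ ?_ ?_ ?_ ?_ ?_
  · rw [fromRows_mul_fromCols]
    simp [fromBlocks_add, add_assoc, add_self_eq_zero_of_charTwo]
  · simp [fromBlocks_multiply, hS, hS', ← Matrix.mul_assoc S', hSu, Matrix.mul_assoc u, hφS]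
  · simp [fromBlocks_multiply, hP, hP', ← Matrix.mul_assoc, hPw]
    simp [Matrix.mul_assoc, hαP]
  · have h₁ : w * φ * (w * α) = t • (w * α) := by
      rw [Matrix.mul_assoc, ← Matrix.mul_assoc φ, hφw]
      simp
    have h₂ : u * φ * (w * α) = t • (u * α) := by
      rw [Matrix.mul_assoc, ← Matrix.mul_assoc φ, hφw]
      simp
    have h₃ : w * α * (u * φ) = w * φ := by
      rw [Matrix.mul_assoc, ← Matrix.mul_assoc α, hαu, Matrix.one_mul]
    have h₄ : w * α * (u * α) = w * α := by
      rw [Matrix.mul_assoc, ← Matrix.mul_assoc α, hαu, Matrix.one_mul]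
    have h₅ : G * (w * α) = 0 := by rw [← Matrix.mul_assoc, hGw, Matrix.zero_mul]
    have h₆ : P * (w * φ) = w * φ := by rw [← Matrix.mul_assoc, hPw]
    have h₇ : P' * (u * φ) = 0 := by rw [← Matrix.mul_assoc, hPu, Matrix.zero_mul]
    have h₈ : P' * (u * α) = 0 := by rw [← Matrix.mul_assoc, hPu, Matrix.zero_mul]
    have h₉ : w * α * G' = 0 := by rw [Matrix.mul_assoc, hαG, Matrix.mul_zero]
    have h₁₀ : w * φ * P = w * φ := by rw [Matrix.mul_assoc, hφP]
    have h₁₁ : u * φ * P = u * φ := by rw [Matrix.mul_assoc, hφP]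
    have h₁₂ : u * α * P' = 0 := by rw [Matrix.mul_assoc, hαP, Matrix.mul_zero]
    simp only [fromBlocks_multiply, fromBlocks_add, Matrix.add_mul, Matrix.mul_add,
      Matrix.zero_mul, Matrix.mul_zero, Matrix.smul_mul, Matrix.mul_smul, smul_zero, h₁, h₂, h₃,
      h₄, h₅, h₆, h₇, h₈, h₉, h₁₀, h₁₁, h₁₂, add_zero, zero_add, add_self_eq_zero_of_charTwo]
    congr 1
    · rw [add_assoc (P * G), add_self_eq_zero_of_charTwo, add_zero, add_right_comm, hG]
    · rw [add_assoc, hG', add_comm]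
  · simp [fromCols_mul_fromBlocks, hφS', ← Matrix.mul_assoc, hφu]
  · simp [fromBlocks_mul_fromRows, hGw', Matrix.add_mul, Matrix.mul_assoc, hαw]
  · simp [fromCols_mul_fromRows, hφw']
  · intro h
    simp [hs h]
  · rcases hpar with ⟨h₁, h₂⟩ | ⟨h₁, h₂⟩
    · left
      simp [fromBlocks_mul_fromRows, fromCols_mul_fromBlocks, h₁, h₂, Matrix.mul_assoc, hαw]
    · right
      simp [fromBlocks_mul_fromRows, fromCols_mul_fromBlocks, h₁, h₂, Matrix.mul_assoc, hαw]

theorem HasChainForm.directSum [CharP F 2] {A : Matrix m m F} {B : Matrix n n F} {t : F}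
    (hA : HasChainForm A t) (hB : HasChainForm B 0) : HasChainForm (fromBlocks A 0 0 B) t := by
  obtain ⟨S, G, P, w, φ, rfl, hS, hP, hG, hφS, hGw, hPw, hφP, hφw, ht⟩ := hA
  obtain ⟨S', G', P', w', φ', rfl, hS', hP', hG', -, -, -, -, -, h0⟩ := hB
  obtain rfl := h0 rfl
  refine ⟨fromBlocks S 0 0 S', fromBlocks G 0 0 G', fromBlocks P 0 0 P', fromRows w 0,
    fromCols φ 0, ?_, ?_, ?_, ?_, ?_, ?_, ?_, ?_, ?_, ?_⟩
  · rw [fromRows_mul_fromCols]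
    simp [fromBlocks_add]
  · simp [fromBlocks_multiply, hS, hS']
  · simp [fromBlocks_multiply, hP, hP']
  · simp [fromBlocks_multiply, fromBlocks_add, hG, hG']
  · simp [fromCols_mul_fromBlocks, hφS]
  · simp [fromBlocks_mul_fromRows, hGw]
  · simp [fromBlocks_mul_fromRows, hPw]
  · simp [fromCols_mul_fromBlocks, hφP]
  · simp [fromCols_mul_fromRows, hφw]
  · intro h
    simp [ht h]

theorem hasChainForm_of_isEmpty [IsEmpty n] (A : Matrix n n F) : HasChainForm A 0 :=
  ⟨0, 0, 0, 0, 0, Subsingleton.elim _ _, by simp, by simp, by simp, by simp, by simp, by simp,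
    by simp, by simp, fun _ => rfl⟩

/-- The grading on two copies of the same block: the odd part `fromBlocks A 1 0 A` is conjugate to
`fromBlocks 0 1 (A ^ 2) 0` in characteristic two. -/
theorem hasChainForm_fromBlocks_self [CharP F 2] [DecidableEq n] (A : Matrix n n F) :
    HasChainForm (fromBlocks A 0 0 A) 0 :=
  ⟨fromBlocks 0 1 0 0, fromBlocks A 1 0 A, fromBlocks 1 0 A 0, 0, 0,
    by simp [fromBlocks_add, add_self_eq_zero_of_charTwo], by simp [fromBlocks_multiply],
    by simp [fromBlocks_multiply],
    by simp [fromBlocks_multiply, fromBlocks_add, add_self_eq_zero_of_charTwo],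
    by simp, by simp, by simp, by simp, by simp, fun _ => rfl⟩

theorem HasChainForm.trace_eq [CharP F 2] [DecidableEq n] {A : Matrix n n F} {t : F}
    (hA : HasChainForm A t) : A.trace = t := by
  obtain ⟨S, G, P, w, φ, rfl, hS, hP, hG, hφS, hGw, hPw, hφP, hφw, ht⟩ := hA
  have h₁ : S.trace = 0 :=
    (Matrix.isNilpotent_trace_of_isNilpotent ⟨2, by rw [sq, hS]⟩).eq_zero
  have h₂ : G.trace = 0 := by
    rw [← hG, trace_add, trace_mul_comm, CharTwo.add_self_eq_zero]
  rw [trace_add, trace_add, h₁, h₂, trace_mul_comm, hφw]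
  simp [trace]

/-- A block of size one can only close a chain, and only if its entry is the last entry of the
chain. -/
theorem hasLinkForm_smul_one [Unique n] [DecidableEq n] (t : F) :
    HasLinkForm (t • 1 : Matrix n n F) t 0 :=
  ⟨0, 0, 0, Matrix.of fun _ _ => 1, 0, Matrix.of fun _ _ => 1, 0,
    by ext i j; obtain rfl := Subsingleton.elim i j; simp [Matrix.mul_apply],
    by simp, by simp, by simp, by simp, by simp, by simp, fun _ => rfl,
    by ext; simp [Matrix.mul_apply],
    by simp, by simp, by simp, by simp, by simp, by simp, by simp⟩

/-- For last entry zero, the odd part `G` splits as `G * P + P * G`. -/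
theorem HasChainForm.exists_add_add [DecidableEq n] {A : Matrix n n F} (hA : HasChainForm A 0) :
    ∃ S₁ S₂ S₃ : Matrix n n F, S₁ ^ 2 = 0 ∧ S₂ ^ 2 = 0 ∧ S₃ ^ 2 = 0 ∧ A = S₁ + S₂ + S₃ := by
  obtain ⟨S, G, P, w, φ, rfl, hS, hP, hG, -, -, -, -, -, h0⟩ := hA
  obtain rfl := h0 rfl
  have h₁ : P * G * P = 0 := by
    have := congrArg (P * ·) hG
    simpa [mul_add, ← mul_assoc, hP] using this
  refine ⟨S, G * P, P * G, by rw [sq, hS], ?_, ?_, ?_⟩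
  · rw [sq, mul_assoc, ← mul_assoc P, h₁, mul_zero]
  · rw [sq, ← mul_assoc, h₁, zero_mul]
  · rw [Matrix.zero_mul, add_zero, add_assoc, hG]

/-- A matrix that agrees, outside its last column, with the shift plus an entry `a` in the top left
corner is a link. The grading is by the parity of the position. -/
theorem hasLinkForm_of_cyclic {k : ℕ} {a : F} {A : Matrix (Fin (k + 2)) (Fin (k + 2)) F}
    (hA : ∀ i j, j ≠ Fin.last _ → A i j =
      (if i.val = j.val + 1 then 1 else 0) + if i = 0 ∧ j = 0 then a else 0) :
    HasLinkForm A a (A (Fin.last _) (Fin.last _)) := by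
  set b := A (Fin.last _) (Fin.last _) with hb
  let c : Matrix (Fin (k + 2)) Unit F :=
    Matrix.of fun i _ => if i = Fin.last _ then 0 else A i (Fin.last _)
  let e : Fin (k + 2) → Matrix (Fin (k + 2)) Unit F :=
    fun j => Matrix.of fun i _ => if i = j then 1 else 0
  let e' : Fin (k + 2) → Matrix Unit (Fin (k + 2)) F :=
    fun j => Matrix.of fun _ i => if i = j then 1 else 0
  let d : Fin (k + 2) → F := fun i => if Odd i.val then 1 else 0
  let G : Matrix (Fin (k + 2)) (Fin (k + 2)) F :=
    Matrix.of fun i j => if i.val = j.val + 1 then 1 else 0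
  have hec : e' (Fin.last _) * c = 0 := by
    ext
    simp only [mul_apply, e', c, of_apply]
    exact Finset.sum_eq_zero fun j _ => by split_ifs <;> simp
  have hee : ∀ i j, e' i * e j = if i = j then 1 else 0 := by
    intro i j
    ext
    by_cases h : i = j <;> simp [e, e', Matrix.mul_apply, h, eq_comm]
  have hde : ∀ i, diagonal d * e i = d i • e i := by
    intro i; ext x; by_cases h : x = i <;> simp [e, h]
  have hed : ∀ i, e' i * diagonal d = d i • e' i := by
    intro i; ext _ x; by_cases h : x = i <;> simp [e', h]
  refine ⟨c * e' (Fin.last _), G, diagonal d, e 0, b • e (Fin.last _), e' 0, e' (Fin.last _), ?_,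
    ?_, ?_, ?_, ?_, ?_, ?_, ?_, ?_, ?_, ?_, ?_, ?_, ?_, ?_, ?_⟩
  · ext i j
    rcases eq_or_ne j (Fin.last _) with rfl | hj
    · have : i.val ≠ k + 1 + 1 := by omega
      rcases eq_or_ne i (Fin.last _) with rfl | hi
      · simp [Matrix.mul_apply, c, e, e', G, hb]
      · simp [Matrix.mul_apply, c, e, e', G, hi, this]
    · rw [hA i j hj]
      by_cases hi : i = 0 <;> by_cases h0 : j = 0 <;>
        simp [Matrix.mul_apply, c, e, e', G, hj, hi, h0]
  · rw [Matrix.mul_assoc, ← Matrix.mul_assoc (e' _), hec]; simp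
  · rw [diagonal_mul_diagonal]
    congr 1
    ext i
    by_cases h : Odd i.val <;> simp [d, h]
  · ext i j
    by_cases h : i.val = j.val + 1
    · by_cases h' : Even j.val <;> simp [G, d, h, h', parity_simps]
    · simp [G, h]
  · rw [← Matrix.mul_assoc, hec, Matrix.zero_mul]
  · ext i
    have : i.val ≠ k + 1 + 1 := by omega
    simp [G, e, Matrix.mul_apply, this]
  · simp [hee]
  · rintro h
    simp [h]
  · simp [hee]
  · ext
    simp only [mul_apply, e', G, of_apply]
    exact Finset.sum_eq_zero fun j _ => by by_cases h : j = 0 <;> simp [h]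
  · simp [hde, d]
  · simp [hed, d]
  · simp [Matrix.mul_assoc, hee]
  · simp [hee]
  · simp [hee]
  · by_cases h : Even k <;> simp [hde, hed, d, h, parity_simps]

end Blocks

/-! ### Endomorphisms in chain form -/

section Endo

universe u

variable {F V W : Type u} [Field F] [AddCommGroup V] [Module F V] [AddCommGroup W] [Module F W]

namespace LinearMap

/-- The matrix of `f` in some basis has chain form with last entry `t`. -/
def HasChainForm (f : End F V) (t : F) : Prop :=
  ∃ (n : Type) (_ : Fintype n) (_ : DecidableEq n) (b : Basis n F V),
    _root_.HasChainForm (LinearMap.toMatrix b b f) t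

/-- The space has dimension at least two and a basis of the form `v, f v, f (f v), …`. -/
def HasKrylovBasis (f : End F V) : Prop :=
  ∃ (k : ℕ) (v : V) (b : Basis (Fin (k + 2)) F V), ∀ i, b i = (f ^ (i : ℕ)) v

theorem HasChainForm.congr {f : End F V} {g : End F W} {t : F} (hf : HasChainForm f t)
    (e : V ≃ₗ[F] W) (he : ∀ v, e (f v) = g (e v)) : HasChainForm g t := by
  obtain ⟨n, _, _, b, hb⟩ := hf
  refine ⟨n, inferInstance, inferInstance, b.map e, ?_⟩
  convert hb using 1
  ext i j
  simp [LinearMap.toMatrix_apply, ← he]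

theorem HasChainForm.trace_eq [CharP F 2] {f : End F V} {t : F} (hf : HasChainForm f t) :
    LinearMap.trace F V f = t := by
  obtain ⟨n, _, _, b, hb⟩ := hf
  rw [LinearMap.trace_eq_matrix_trace F b, hb.trace_eq]

theorem HasChainForm.prodMap [CharP F 2] {f : End F V} {g : End F W} {t : F} (hf : HasChainForm f t)
    (hg : HasChainForm g 0) : HasChainForm (f.prodMap g) t := by
  obtain ⟨n, _, _, b, hb⟩ := hf
  obtain ⟨m, _, _, c, hc⟩ := hg
  refine ⟨n ⊕ m, inferInstance, inferInstance, b.prod c, ?_⟩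
  rw [toMatrix_prodMap]
  exact hb.directSum hc

theorem hasChainForm_of_subsingleton [Subsingleton V] (f : End F V) : HasChainForm f 0 :=
  ⟨Fin 0, inferInstance, inferInstance, Basis.empty V, hasChainForm_of_isEmpty _⟩

theorem toMatrix_singleton_smul_one (t : F) :
    LinearMap.toMatrix (Basis.singleton Unit F) (Basis.singleton Unit F) (t • 1 : End F F) =
      t • 1 := by
  ext
  simp [LinearMap.toMatrix_apply]

theorem hasChainForm_prodMap_smul_one [CharP F 2] (t : F) :
    HasChainForm ((t • 1 : End F F).prodMap (t • 1 : End F F)) 0 := by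
  refine ⟨Unit ⊕ Unit, inferInstance, inferInstance,
    (Basis.singleton Unit F).prod (Basis.singleton Unit F), ?_⟩
  rw [toMatrix_prodMap]
  exact hasChainForm_fromBlocks_self _

theorem HasChainForm.prodMap_smul_one [CharP F 2] {f : End F V} {t : F} (hf : HasChainForm f t) :
    HasChainForm (f.prodMap (t • 1 : End F F)) 0 := by
  obtain ⟨n, _, _, b, hb⟩ := hf
  refine ⟨n ⊕ Unit, inferInstance, inferInstance, b.prod (Basis.singleton Unit F), ?_⟩
  rw [toMatrix_prodMap, toMatrix_singleton_smul_one]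
  exact hb.directSum_link (hasLinkForm_smul_one t)

/-- The basis `v, (g - a) v, g (g - a) v, g² (g - a) v, …` puts `a` into the top left corner. -/
theorem HasKrylovBasis.exists_hasLinkForm {g : End F W} (hg : HasKrylovBasis g) (a : F) :
    ∃ (n : Type) (_ : Fintype n) (_ : DecidableEq n) (b : Basis n F W) (s : F),
      HasLinkForm (LinearMap.toMatrix b b g) a s := by
  obtain ⟨k, v, b, hb⟩ := hg
  let c : Fin (k + 2) → W := Fin.cons v fun j => (g ^ (j + 1 : ℕ)) v - a • (g ^ (j : ℕ)) v
  have hspan : ⊤ ≤ Submodule.span F (Set.range c) := by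
    rw [← b.span_eq, Submodule.span_le]
    rintro _ ⟨i, rfl⟩
    induction i using Fin.induction with
    | zero => exact Submodule.subset_span ⟨0, by simp [c, hb]⟩
    | succ j ih =>
      have : b j.succ = c j.succ + a • b j.castSucc := by simp [c, hb]
      rw [this]
      exact Submodule.add_mem _ (Submodule.subset_span ⟨_, rfl⟩) (Submodule.smul_mem _ _ ih)
  let c' := basisOfTopLeSpanOfCardEqFinrank c hspan (Module.finrank_eq_card_basis b).symm
  have hc' : ⇑c' = c := coe_basisOfTopLeSpanOfCardEqFinrank _ _ _
  have hgc : ∀ j : Fin (k + 1), g (c j.castSucc) = c j.succ + if j = 0 then a • c 0 else 0 := by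
    intro j
    induction j using Fin.cases with
    | zero => simp [c]
    | succ j =>
      simp [c, pow_succ']
  refine ⟨Fin (k + 2), inferInstance, inferInstance, c', _,
    hasLinkForm_of_cyclic (a := a) fun i j hj => ?_⟩
  obtain ⟨j, rfl⟩ := Fin.exists_castSucc_eq.2 hj
  rw [LinearMap.toMatrix_apply, hc', hgc, ← hc']
  have : (i : ℕ) = j + 1 ↔ j.succ = i := by rw [Fin.ext_iff]; simp [eq_comm]
  simp only [Fin.val_castSucc, this]
  by_cases h : j = 0
  · simp [Finsupp.single_apply, h, eq_comm]
  · simp [Finsupp.single_apply, h]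

theorem HasChainForm.prodMap_krylov [CharP F 2] {f : End F V} {g : End F W} {t : F}
    (hf : HasChainForm f t) (hg : HasKrylovBasis g) : ∃ s, HasChainForm (f.prodMap g) s := by
  obtain ⟨n, _, _, b, hb⟩ := hf
  obtain ⟨m, _, _, c, s, hc⟩ := hg.exists_hasLinkForm t
  refine ⟨s, n ⊕ m, inferInstance, inferInstance, b.prod c, ?_⟩
  rw [toMatrix_prodMap]
  exact hb.directSum_link hc

theorem hasKrylovBasis_prodMap_smul_one {a b : F} (h : a ≠ b) :
    HasKrylovBasis ((a • 1 : End F F).prodMap (b • 1 : End F F)) := by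
  let c : Fin 2 → F × F := ![(1, 1), (a, b)]
  have hc : LinearIndependent F c := by
    rw [LinearIndependent.pair_iff]
    intro s t hst
    simp only [Prod.ext_iff, Prod.fst_add, Prod.snd_add, Prod.smul_fst, Prod.smul_snd, smul_eq_mul,
      Prod.fst_zero, Prod.snd_zero] at hst
    have : t * (a - b) = 0 := by linear_combination hst.1 - hst.2
    have ht : t = 0 := by simpa [sub_ne_zero.2 h] using this
    exact ⟨by simpa [ht] using hst.1, ht⟩
  refine ⟨0, (1, 1), basisOfLinearIndependentOfCardEqFinrank hc (by simp), fun i => ?_⟩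
  fin_cases i <;> simp [c]

/-- The endomorphism has chain form for some last entry, or it is the direct sum of one that has
chain form and of a scalar acting on a line. -/
def IsAlmostChain (f : End F V) : Prop :=
  (∃ t, HasChainForm f t) ∨
    ∃ (V' : Type u) (_ : AddCommGroup V') (_ : Module F V') (f' : End F V') (t a : F)
      (e : V ≃ₗ[F] V' × F), HasChainForm f' t ∧ ∀ v, e (f v) = f'.prodMap (a • 1 : End F F) (e v)

theorem IsAlmostChain.congr {f : End F V} {g : End F W} (hf : IsAlmostChain f)
    (e : V ≃ₗ[F] W) (he : ∀ v, e (f v) = g (e v)) : IsAlmostChain g := by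
  rcases hf with ⟨t, h⟩ | ⟨V', _, _, f', t, a, e', h, he'⟩
  · exact Or.inl ⟨t, h.congr e he⟩
  · refine Or.inr ⟨V', _, _, f', t, a, e.symm.trans e', h, fun v => ?_⟩
    obtain ⟨v, rfl⟩ := e.surjective v
    simp [← he, he']

theorem IsAlmostChain.prodMap_krylov [CharP F 2] {f : End F V} {g : End F W} (hf : IsAlmostChain f)
    (hg : HasKrylovBasis g) : IsAlmostChain (f.prodMap g) := by
  rcases hf with ⟨t, h⟩ | ⟨V', _, _, f', t, a, e, h, he⟩
  · exact Or.inl (h.prodMap_krylov hg)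
  · obtain ⟨s, hs⟩ := h.prodMap_krylov hg
    refine Or.inr ⟨V' × W, _, _, f'.prodMap g, s, a,
      (e.prodCongr (LinearEquiv.refl F W)).trans ((LinearEquiv.prodAssoc F V' F W).trans
        (((LinearEquiv.refl F V').prodCongr (LinearEquiv.prodComm F F W)).trans
          (LinearEquiv.prodAssoc F V' W F).symm)), hs, ?_⟩
    rintro ⟨v, x⟩
    simp only [LinearMap.prodMap_apply, LinearEquiv.trans_apply, LinearEquiv.prodCongr_apply, he]
    rfl

/-- A second line can always be absorbed: two lines form a cyclic block if their eigenvalues differ,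
and a block that decomposes by itself if they agree. -/
theorem IsAlmostChain.prodMap_smul_one [CharP F 2] {f : End F V} (hf : IsAlmostChain f) (b : F) :
    IsAlmostChain (f.prodMap (b • 1 : End F F)) := by
  rcases hf with ⟨t, h⟩ | ⟨V', _, _, f', t, a, e, h, he⟩
  · exact Or.inr ⟨V, _, _, f, t, b, LinearEquiv.refl F _, h, fun _ => rfl⟩
  · have key : ∃ s, HasChainForm (f'.prodMap ((a • 1 : End F F).prodMap (b • 1 : End F F))) s := by
      rcases eq_or_ne a b with rfl | hab
      · exact ⟨t, h.prodMap (hasChainForm_prodMap_smul_one a)⟩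
      · exact h.prodMap_krylov (hasKrylovBasis_prodMap_smul_one hab)
    obtain ⟨s, hs⟩ := key
    refine Or.inl ⟨s, hs.congr ((LinearEquiv.prodAssoc F V' F F).symm.trans
      (e.symm.prodCongr (LinearEquiv.refl F F))) ?_⟩
    rintro ⟨v, x, y⟩
    have : e.symm (f' v, a • x) = f (e.symm (v, x)) := by
      rw [LinearEquiv.symm_apply_eq, he, LinearEquiv.apply_symm_apply]
      rfl
    exact Prod.ext this rfl

/-- If the trace is zero, the eigenvalue on the leftover line is the last entry of the chain, so the
line can be appended to the chain. -/
theorem IsAlmostChain.hasChainForm_zero [CharP F 2] [FiniteDimensional F V] {f : End F V}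
    (hf : IsAlmostChain f) (h0 : LinearMap.trace F V f = 0) : HasChainForm f 0 := by
  rcases hf with ⟨t, h⟩ | ⟨V', _, _, f', t, a, e, h, he⟩
  · obtain rfl : t = 0 := h.trace_eq ▸ h0
    exact h
  · have : FiniteDimensional F (V' × F) := Module.Finite.equiv e
    have : FiniteDimensional F V' :=
      Module.Finite.of_surjective (LinearMap.fst F V' F) LinearMap.fst_surjective
    have hconj : e.conj f = f'.prodMap (a • 1 : End F F) := by
      refine LinearMap.ext fun x => ?_
      rw [LinearEquiv.conj_apply_apply, he, LinearEquiv.apply_symm_apply]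
    have hta : t = a := by
      rw [← LinearMap.trace_conj' f e, hconj, LinearMap.trace_prodMap', h.trace_eq] at h0
      simpa [CharTwo.add_eq_zero] using h0
    subst hta
    exact h.prodMap_smul_one.congr e.symm fun v => by
      rw [LinearEquiv.symm_apply_eq, he, LinearEquiv.apply_symm_apply]

/-- The blocks of a cyclic decomposition, sorted by dimension: zero, one, or at least two. -/
inductive IsElementaryBlock (f : End F V) : Prop
  | subsingleton (h : Subsingleton V)
  | scalar (e : V ≃ₗ[F] F) (a : F) (h : f = a • 1)
  | krylov (h : HasKrylovBasis f)

theorem IsAlmostChain.prodMap_isElementaryBlock [CharP F 2] {f : End F V} {g : End F W}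
    (hf : IsAlmostChain f) (hg : IsElementaryBlock g) : IsAlmostChain (f.prodMap g) := by
  rcases hg with h | ⟨e, a, rfl⟩ | h
  · let _ : Unique W := uniqueOfSubsingleton 0
    exact hf.congr (LinearEquiv.prodUnique (R := F) (M := V) (M₂ := W)).symm fun v =>
      Prod.ext rfl (Subsingleton.elim _ _)
  · refine (hf.prodMap_smul_one a).congr ((LinearEquiv.refl F V).prodCongr e.symm) ?_
    rintro ⟨v, x⟩
    exact Prod.ext rfl (map_smul e.symm a x)
  · exact hf.prodMap_krylov h

theorem isAlmostChain_pi [CharP F 2] {ι : Type u} [Finite ι] :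
    ∀ (M : ι → Type u) [∀ i, AddCommGroup (M i)] [∀ i, Module F (M i)]
    (f : ∀ i, End F (M i)), (∀ i, IsElementaryBlock (f i)) →
    IsAlmostChain (LinearMap.pi fun i => f i ∘ₗ LinearMap.proj i : End F (∀ i, M i)) := by
  induction ι using Finite.induction_empty_option with
  | of_equiv e ih =>
    intro M _ _ f hf
    refine (ih (fun i => M (e i)) (fun i => f (e i)) fun i => hf _).congr
      (LinearEquiv.piCongrLeft F M e) fun v => ?_
    ext i
    obtain ⟨j, rfl⟩ := e.surjective i
    have h : ∀ w, LinearEquiv.piCongrLeft F M e w (e j) = w j :=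
      fun w => Equiv.piCongrLeft_apply_apply M e w j
    simp [h]
  | h_empty =>
    intro M _ _ f hf
    exact Or.inl ⟨0, hasChainForm_of_subsingleton _⟩
  | h_option ih =>
    intro M _ _ f hf
    have := (ih (fun i => M (some i)) (fun i => f (some i))
      fun i => hf _).prodMap_isElementaryBlock (hf none)
    let e : (∀ i, M i) ≃ₗ[F] (∀ i, M (some i)) × M none :=
      { toFun v := (fun i => v (some i), v none)
        invFun v i := Option.rec v.2 v.1 i
        map_add' _ _ := rfl
        map_smul' _ _ := rfl
        left_inv v := by ext i; cases i <;> rfl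
        right_inv v := rfl }
    refine this.congr e.symm fun v => ?_
    rw [LinearEquiv.symm_apply_eq]
    rfl

/-! ### Decomposition into cyclic blocks -/

theorem isElementaryBlock_lsmul_X_quotient {q : F[X]} (hq : q ≠ 0) :
    IsElementaryBlock (Algebra.lsmul F F (F[X] ⧸ (F[X] ∙ q)) (X : F[X])) := by
  set f := Algebra.lsmul F F (F[X] ⧸ (F[X] ∙ q)) (X : F[X])
  obtain ⟨d, v, b, hb⟩ : ∃ (d : ℕ) (v : F[X] ⧸ (F[X] ∙ q))
      (b : Basis (Fin d) F (F[X] ⧸ (F[X] ∙ q))),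
      ∀ i, b i = (f ^ (i : ℕ)) v := by
    -- `AdjoinRoot q` is this quotient by definition, so its power basis can be used.
    refine ⟨_, AdjoinRoot.mk q 1, (AdjoinRoot.powerBasis hq).basis, fun i => ?_⟩
    have h : (AdjoinRoot.powerBasis hq).basis i = AdjoinRoot.mk q (X ^ (i : ℕ) * 1) := by
      simp
    refine h.trans ?_
    rw [← map_pow]
    rfl
  match d with
  | 0 => exact .subsingleton b.repr.toEquiv.subsingleton
  | 1 =>
    refine .scalar (b.equivFun.trans (LinearEquiv.funUnique (Fin 1) F F)) (b.repr (f (b 0)) 0) ?_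
    refine b.ext fun i => ?_
    obtain rfl := Subsingleton.elim i 0
    conv_lhs => rw [← b.sum_repr (f (b 0))]
    simp
  | k + 2 => exact .krylov ⟨k, v, b, hb⟩

/-- The structure theorem for finitely generated torsion modules over `F[X]`, applied to the module
defined by `f`, provides the decomposition into cyclic blocks. -/
theorem isAlmostChain_of_finite [CharP F 2] [FiniteDimensional F V] (f : End F V) :
    IsAlmostChain f := by
  obtain ⟨ι, _, p, hp, k, ⟨e⟩⟩ := Module.equiv_directSum_of_isTorsion (R := F[X]) (M := AEval' f)
    (AEval.isTorsion_of_finiteDimensional F V f)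
  let M : ι → Type u := fun i => F[X] ⧸ (F[X] ∙ p i ^ k i)
  let e₁ : AEval' f ≃ₗ[F[X]] ∀ i, M i := e.trans (DirectSum.linearEquivFunOnFintype F[X] ι M)
  refine (isAlmostChain_pi M (fun i => Algebra.lsmul F F (M i) (X : F[X])) fun i =>
    isElementaryBlock_lsmul_X_quotient (pow_ne_zero _ (hp i).ne_zero)).congr
    ((AEval'.of f).trans (e₁.restrictScalars F)).symm fun v => ?_
  rw [LinearEquiv.symm_apply_eq]
  obtain ⟨v, rfl⟩ := e₁.surjective v
  have : (LinearMap.pi fun i => Algebra.lsmul F F (M i) (X : F[X]) ∘ₗ LinearMap.proj i :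
      End F (∀ i, M i)) (e₁ v) = e₁ ((X : F[X]) • v) := by
    rw [map_smul]
    rfl
  rw [this]
  obtain ⟨v, rfl⟩ := (AEval'.of f).surjective v
  rw [AEval'.X_smul_of]
  simp

end LinearMap

end Endo

theorem mainTheorem10 {F : Type*} [Field F] [CharP F 2] (n : ℕ) (A : Matrix (Fin n) (Fin n) F) :
    (∃ S₁ S₂ S₃ : Matrix (Fin n) (Fin n) F,
      S₁ ^ 2 = 0 ∧ S₂ ^ 2 = 0 ∧ S₃ ^ 2 = 0 ∧ A = S₁ + S₂ + S₃) ↔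
    A.trace = 0 := by
  constructor
  · rintro ⟨S₁, S₂, S₃, h₁, h₂, h₃, rfl⟩
    have key : ∀ S : Matrix (Fin n) (Fin n) F, S ^ 2 = 0 → S.trace = 0 := fun S hS =>
      (Matrix.isNilpotent_trace_of_isNilpotent ⟨2, hS⟩).eq_zero
    simp [trace_add, key _ h₁, key _ h₂, key _ h₃]
  · intro hA
    obtain ⟨m, _, _, b, hb⟩ := (LinearMap.isAlmostChain_of_finite (toLin' A)).hasChainForm_zero
      (by rwa [trace_toLin'_eq])
    obtain ⟨S₁, S₂, S₃, h₁, h₂, h₃, h⟩ := hb.exists_add_add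
    have key : ∀ S : Matrix m m F, S ^ 2 = 0 → (LinearMap.toMatrix' (toLin b b S)) ^ 2 = 0 :=
      fun S hS => by
      rw [sq, ← LinearMap.toMatrix'_mul, Module.End.mul_eq_comp, ← toLin_mul, ← sq, hS,
        map_zero, map_zero]
    refine ⟨_, _, _, key S₁ h₁, key S₂ h₂, key S₃ h₃, ?_⟩
    rw [← map_add, ← map_add, ← map_add, ← map_add, ← h, toLin_toMatrix,
      LinearMap.toMatrix'_toLin']
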